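/- Let $q\ge 6$ be a prime power. In $\mathrm{PG}(6,q)$ let $\mathcal C$ be a non-degenerate conic in a plane $\alpha$ and let $\mathcal N_3$ be a twisted cubic in a $3$-space $\Pi_3$ with $\alpha\cap\Pi_3=\emptyset$. In suitable coordinates of $\alpha$ and of $\Pi_3$ write $\mathcal C=\{C_\theta=(1,\theta,\theta^2)\mid\theta\in\mathbb F_q\cup\{\infty\}\}$ and $\mathcal N_3=\{N_\epsilon=(1,\epsilon,\epsilon^2,\epsilon^3)\mid\epsilon\in\mathbb F_q\cup\{\infty\}\}$, where $C_\infty=(0,0,1)$ and $N_\infty=(0,0,0,1)$, and let $\phi\in\mathrm{PGL}(2,q)$ act on the parameters $\mathbb F_q\cup\{\infty\}$. Let $V$ (a ruled quintic surface) be the set of points on the $q+1$ lines $C_\theta N_{\phi(\theta)}$, $\theta\in\mathbb F_q\cup\{\infty\}$. These lines are called the generators of $V$, and $\mathcal C$ is called its conic directrix. A twisted cubic of $\mathrm{PG}(6,q)$ is a set of points that has the form $\{(1,\theta,\theta^2,\theta^3)\mid\theta\in\mathbb F_q\cup\{\infty\}\}$ in suitable coordinates of some $3$-space, with $(0,0,0,1)$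 as the point for $\theta=\infty$; it is a twisted cubic on $V$ if it is contained in $V$. Then: 1. Any two distinct twisted cubics on $V$ meet in a unique point. 2. If $P,Q$ are points that lie on different generators of $V$ and do not lie on the conic directrix, then $P,Q$ lie on a unique twisted cubic on $V$. -/

import Mathlib

open scoped LinearAlgebra.Projectivization MatrixGroups

namespace RuledQuintic

/-- The points of the projective space of `E` that lie in the projective subspace attached to the
vector subspace `W` (of vector dimension `r + 1` for a projective `r`-space). -/
def pointsOf {F E : Type*} [Field F] [AddCommGroup E] [Module F E] (W : Submodule F E) :
    Set (ℙ F E) :=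
  {P | P.submodule ≤ W}

section NormalRationalCurve

variable {F E : Type*} [Field F] [AddCommGroup E] [Module F E]

/-- The vector `x ^ n • v 0 + x ^ (n - 1) y • v 1 + ⋯ + y ^ n • v n` for `p = (x, y)`. -/
def nrcVec {n : ℕ} (v : Fin (n + 1) → E) (p : Fin 2 → F) : E :=
  ∑ i : Fin (n + 1), ((p 0) ^ (n - (i : ℕ)) * (p 1) ^ (i : ℕ)) • v i

theorem nrcVec_smul {n : ℕ} (v : Fin (n + 1) → E) (t : F) (p : Fin 2 → F) :
    nrcVec v (t • p) = t ^ n • nrcVec v p := by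
  unfold nrcVec
  rw [Finset.smul_sum]
  refine Finset.sum_congr rfl fun i _ => ?_
  rw [smul_smul]
  congr 1
  have h : t ^ n = t ^ (n - (i : ℕ)) * t ^ (i : ℕ) := by
    rw [← pow_add]; congr 1; omega
  rw [h]
  simp only [Pi.smul_apply, smul_eq_mul, mul_pow]
  ring

theorem nrcVec_ne_zero {n : ℕ} {v : Fin (n + 1) → E} (hv : LinearIndependent F v)
    {p : Fin 2 → F} (hp : p ≠ 0) : nrcVec v p ≠ 0 := by
  intro h
  have key := Fintype.linearIndependent_iff.1 hv _ h
  have h0 := key 0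
  have h1 := key (Fin.last n)
  simp only [Fin.val_zero, Nat.sub_zero, pow_zero, mul_one, Fin.val_last, Nat.sub_self,
    one_mul] at h0 h1
  apply hp
  funext j
  fin_cases j
  · exact eq_zero_of_pow_eq_zero h0
  · exact eq_zero_of_pow_eq_zero h1

/-- The point with parameter `(x : y)` of the normal rational curve with coordinate frame `v`;
with the non-homogeneous parameter `θ = y / x` it is `(1, θ, θ ^ 2, …, θ ^ n)` in the coordinates
given by `v`, and the parameter `∞` gives `(0, …, 0, 1)`. -/
def nrcPoint {n : ℕ} (v : Fin (n + 1) → E) (hv : LinearIndependent F v)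
    (θ : ℙ F (Fin 2 → F)) : ℙ F E :=
  θ.lift (fun p => Projectivization.mk F (nrcVec v p.1) (nrcVec_ne_zero hv p.2)) (by
    intro a b t h
    rw [Projectivization.mk_eq_mk_iff']
    exact ⟨t ^ n, by rw [h, nrcVec_smul]⟩)

/-- `N` is an `n`-dimensional normal rational curve: in suitable coordinates of some projective
`n`-space it is `{(1, θ, …, θ ^ n) | θ ∈ F ∪ {∞}}`. -/
def IsNormalRationalCurve (n : ℕ) (N : Set (ℙ F E)) : Prop :=
  ∃ (v : Fin (n + 1) → E) (hv : LinearIndependent F v), N = Set.range (nrcPoint v hv)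

/-- A twisted cubic: a `3`-dimensional normal rational curve. -/
def IsTwistedCubic (N : Set (ℙ F E)) : Prop :=
  IsNormalRationalCurve 3 N

end NormalRationalCurve

/-- The data of a scroll of `PG(6, F)` ruling a non-degenerate conic and a twisted cubic by a
projectivity. The vectors `c` are a coordinate frame of the plane `α` in which the conic is
`{(1, θ, θ ^ 2)}`, the vectors `d` are a coordinate frame of the 3-space `Π₃` in which the twisted
cubic is `{(1, θ, θ ^ 2, θ ^ 3)}`, and `φ` acts on the parameters. -/
structure Scroll (F : Type*) [Field F] where
  c : Fin 3 → (Fin 7 → F)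
  linearIndependent_c : LinearIndependent F c
  d : Fin 4 → (Fin 7 → F)
  linearIndependent_d : LinearIndependent F d
  disjoint : Disjoint (pointsOf (Submodule.span F (Set.range c)))
    (pointsOf (Submodule.span F (Set.range d)))
  φ : PGL(Fin 2, F)

namespace Scroll

variable {F : Type*} [Field F] (S : Scroll F)

/-- The conic directrix. -/
def conicDirectrix : Set (ℙ F (Fin 7 → F)) :=
  Set.range (nrcPoint S.c S.linearIndependent_c)

/-- The generator through the point of the conic directrix with parameter `θ`: the line joining it
to the point with parameter `φ θ` of the twisted cubic directrix. -/
def generator (θ : ℙ F (Fin 2 → F)) : Set (ℙ F (Fin 7 → F)) :=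
  pointsOf ((nrcPoint S.c S.linearIndependent_c θ).submodule ⊔
    (nrcPoint S.d S.linearIndependent_d (S.φ • θ)).submodule)

/-- The set of the generators, which are lines of `PG(6, F)` given by their point sets. -/
def generators : Set (Set (ℙ F (Fin 7 → F))) :=
  Set.range S.generator

/-- The points of the ruled quintic surface: the points on the generators. -/
def surface : Set (ℙ F (Fin 7 → F)) :=
  ⋃ θ, S.generator θ

end Scroll

end RuledQuintic

/-! Reparametrizing the conic by the inverse of φ makes both directrices run over the same parameter
p = (x, y). In a basis adapted to the plane and the 3-space (`Scroll.exists_basis`), a point of V is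
s·(x², xy, y²) + t·(x³, x²y, xy², y³), and it lies off the conic directrix only if t ≠ 0.

The twisted cubics on V are exactly the sections s = (a x + b y) t. Both claims then become linear
algebra in (a, b): two distinct linear forms agree at exactly one parameter
(`existsUnique_mem_sectionCubic`), and a linear form is determined by its values at two distinct
parameters (Cramer's rule).

The real work is the classification `exists_eq_smul_sectionFrame`. Project a twisted cubic on V to
the 3-space. Root counting shows that this projection is invertible (`det_ne_zero_of_scrollVec`), so
the cubic meets every generator exactly once. Its conic part is then given by three cubic forms in p
proportional to x², xy, y² at every parameter, which forces a common linear factor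
(`coefficients_of_proportional`). The bound on q supplies enough parameters for these counts. -/

namespace RuledQuintic

/-! ### Independence of points on normal rational curves and zeros of binary forms. -/

section NormalRationalCurves

variable {F E : Type*} [Field F] [AddCommGroup E] [Module F E]

/-- The determinant of two vectors of the plane. -/
def cross (p p' : Fin 2 → F) : F := p 0 * p' 1 - p 1 * p' 0

theorem exists_smul_eq_of_cross_eq_zero {p p' : Fin 2 → F} (hp : p ≠ 0) (hp' : p' ≠ 0)
    (h : cross p p' = 0) : ∃ t : F, t ≠ 0 ∧ p' = t • p := by
  have key : ∃ t : F, p' = t • p := by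
    unfold cross at h
    by_cases h0 : p 0 = 0
    · have h1 : p 1 ≠ 0 := by
        intro h1
        apply hp
        funext j
        fin_cases j <;> simpa
      refine ⟨p' 1 / p 1, ?_⟩
      funext j
      fin_cases j
      · have : p' 0 = 0 := by simpa [h0, h1] using h
        simp [h0, this]
      · simp [h1]
    · refine ⟨p' 0 / p 0, ?_⟩
      funext j
      fin_cases j
      · simp [h0]
      · simp only [Fin.mk_one, Pi.smul_apply, smul_eq_mul]
        field_simp
        linear_combination h
  obtain ⟨t, ht⟩ := key
  refine ⟨t, ?_, ht⟩
  rintro rfl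
  exact hp' (by simpa using ht)

theorem eq_of_cross_rep_eq_zero {θ θ' : ℙ F (Fin 2 → F)} (h : cross θ.rep θ'.rep = 0) :
    θ = θ' := by
  obtain ⟨t, -, ht⟩ := exists_smul_eq_of_cross_eq_zero θ.rep_nonzero θ'.rep_nonzero h
  rw [← θ.mk_rep, ← θ'.mk_rep, eq_comm, Projectivization.mk_eq_mk_iff']
  exact ⟨t, ht.symm⟩

/-- The vector of the monomials of degree `n` in `p`. -/
def monomials (n : ℕ) (p : Fin 2 → F) : Fin (n + 1) → F :=
  fun i => p 0 ^ (n - (i : ℕ)) * p 1 ^ (i : ℕ)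

theorem nrcVec_eq_sum {n : ℕ} (v : Fin (n + 1) → E) (p : Fin 2 → F) :
    nrcVec v p = ∑ i, monomials n p i • v i := rfl

theorem monomials_smul (n : ℕ) (t : F) (p : Fin 2 → F) :
    monomials n (t • p) = t ^ n • monomials n p := by
  funext i
  have h : t ^ n = t ^ (n - (i : ℕ)) * t ^ (i : ℕ) := by
    rw [← pow_add]; congr 1; omega
  simp only [monomials, Pi.smul_apply, smul_eq_mul, mul_pow, h]
  ring

/-- The homogeneous Vandermonde determinant is a product of the pairwise cross products, up to sign.
-/
theorem linearIndependent_monomials_of_cross {n : ℕ} {p : Fin (n + 1) → Fin 2 → F}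
    (hp : Pairwise fun i j => cross (p i) (p j) ≠ 0) :
    LinearIndependent F fun i => monomials n (p i) := by
  have hM : (Matrix.projVandermonde (fun i => p i 1) fun i => p i 0).det ≠ 0 := by
    rw [Matrix.det_projVandermonde]
    refine Finset.prod_ne_zero_iff.2 fun i _ => Finset.prod_ne_zero_iff.2 fun j hj => ?_
    have := hp (ne_of_lt (Finset.mem_Ioi.1 hj))
    unfold cross at this
    contrapose! this
    linear_combination this
  have h := Matrix.linearIndependent_rows_of_det_ne_zero hM
  have heq : (fun i => monomials n (p i)) =
      (Matrix.projVandermonde (fun i => p i 1) fun i => p i 0).row := by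
    funext i j
    simp only [monomials, Matrix.row, Matrix.projVandermonde_apply, Fin.val_rev]
    rw [mul_comm]
    congr 2
    omega
  rw [heq]
  exact h

/-- At most `n + 1` points of a normal rational curve are independent. -/
theorem linearIndependent_monomials [Finite F] {n : ℕ} {S : Finset (ℙ F (Fin 2 → F))}
    (hS : S.card ≤ n + 1) (hn : n + 1 ≤ Nat.card (ℙ F (Fin 2 → F))) :
    LinearIndependent F fun θ : S => monomials n (θ : ℙ F (Fin 2 → F)).rep := by
  classical
  have := Fintype.ofFinite (ℙ F (Fin 2 → F))
  obtain ⟨T, hST, hT⟩ := Finset.exists_superset_card_eq hS (by rwa [Nat.card_eq_fintype_card] at hn)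
  have e : Fin (n + 1) ≃ T := (T.equivFinOfCardEq hT).symm
  have h : LinearIndependent F fun i => monomials n (e i : ℙ F (Fin 2 → F)).rep := by
    refine linearIndependent_monomials_of_cross fun i j hij h0 => hij ?_
    exact e.injective (Subtype.ext (eq_of_cross_rep_eq_zero h0))
  have h' : LinearIndependent F fun θ : T => monomials n (θ : ℙ F (Fin 2 → F)).rep :=
    (linearIndependent_equiv e).1 h
  exact h'.comp (fun θ : S => (⟨θ, hST θ.2⟩ : T)) fun a b hab =>
    Subtype.ext (congrArg (fun x : T => (x : ℙ F (Fin 2 → F))) hab)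

theorem nrcVec_eq_linearCombination {n : ℕ} (v : Fin (n + 1) → E) (p : Fin 2 → F) :
    nrcVec v p = Fintype.linearCombination F v (monomials n p) := rfl

theorem linearIndependent_nrcVec [Finite F] {n : ℕ} {v : Fin (n + 1) → E}
    (hv : LinearIndependent F v) {S : Finset (ℙ F (Fin 2 → F))}
    (hS : S.card ≤ n + 1) (hn : n + 1 ≤ Nat.card (ℙ F (Fin 2 → F))) :
    LinearIndependent F fun θ : S => nrcVec v (θ : ℙ F (Fin 2 → F)).rep :=
  (linearIndependent_monomials hS hn).map' (Fintype.linearCombination F v)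
    (LinearMap.ker_eq_bot.2 (linearIndependent_iff_injective_fintypeLinearCombination.1 hv))

/-- One curve point more than the dimension of U would still be an independent family. Used for
twisted cubics: a line holds at most 2 of their points, a plane at most 3. -/
theorem card_le_finrank_of_nrcVec_mem [Finite F] {n : ℕ} {v : Fin (n + 1) → E}
    (hv : LinearIndependent F v) {S : Finset (ℙ F (Fin 2 → F))}
    (hn : n + 1 ≤ Nat.card (ℙ F (Fin 2 → F))) {U : Submodule F E} [FiniteDimensional F U]
    (hU : Module.finrank F U < n + 1) (h : ∀ θ ∈ S, nrcVec v θ.rep ∈ U) :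
    S.card ≤ Module.finrank F U := by
  by_contra! hlt
  obtain ⟨T, hTS, hT⟩ := Finset.exists_subset_card_eq (Nat.succ_le_of_lt hlt)
  have hli := linearIndependent_nrcVec hv (S := T) (by omega) hn
  have hli' : LinearIndependent F
      fun θ : T => (⟨nrcVec v (θ : ℙ F (Fin 2 → F)).rep, h θ (hTS θ.2)⟩ : U) :=
    LinearIndependent.of_comp U.subtype hli
  have := hli'.fintype_card_le_finrank
  rw [Fintype.card_coe] at this
  omega

/-- A binary form of degree `n` with more than `n` zeros vanishes. -/
theorem eq_zero_of_nrcVec_eq_zero [Finite F] {n : ℕ} (k : Fin (n + 1) → F)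
    {S : Finset (ℙ F (Fin 2 → F))} (hS : n + 1 ≤ S.card)
    (h : ∀ θ ∈ S, nrcVec k θ.rep = 0) : k = 0 := by
  have hn : n + 1 ≤ Nat.card (ℙ F (Fin 2 → F)) := by
    have := Fintype.ofFinite (ℙ F (Fin 2 → F))
    rw [Nat.card_eq_fintype_card]
    exact hS.trans (Finset.card_le_univ S)
  obtain ⟨T, hTS, hT⟩ := Finset.exists_subset_card_eq hS
  have hli := linearIndependent_monomials (n := n) (S := T) hT.le hn
  have hspan := hli.span_eq_top_of_card_eq_finrank' (by simp [hT])
  have hz : Fintype.linearCombination F k = 0 := by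
    refine LinearMap.ext_on_range hspan fun θ => ?_
    exact h θ (hTS θ.2)
  funext i
  simpa using LinearMap.congr_fun hz (Pi.single i 1)

/-- A binary form of degree `n` can separate a point from `n` others. -/
theorem exists_nrcVec_ne_zero [Finite F] {n : ℕ} (hn : n + 1 ≤ Nat.card (ℙ F (Fin 2 → F)))
    {S : Finset (ℙ F (Fin 2 → F))} (hS : S.card ≤ n) {r : ℙ F (Fin 2 → F)} (hr : r ∉ S) :
    ∃ k : Fin (n + 1) → F, nrcVec k r.rep ≠ 0 ∧ ∀ θ ∈ S, nrcVec k θ.rep = 0 := by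
  classical
  have hli := linearIndependent_monomials (n := n) (S := insert r S)
    (by rw [Finset.card_insert_of_notMem hr]; omega) hn
  have hnot := hli.notMem_span_image (s := {θ | (θ : ℙ F (Fin 2 → F)) ∈ S})
    (x := ⟨r, Finset.mem_insert_self r S⟩) (by simpa using hr)
  obtain ⟨f, hf, hker⟩ := Submodule.exists_le_ker_of_notMem hnot
  have key : ∀ p, nrcVec (fun i => f (Pi.single i 1)) p = f (monomials n p) := by
    intro p
    conv_rhs => rw [← Finset.univ_sum_single (monomials n p)]
    simp only [nrcVec_eq_sum, map_sum]
    refine Finset.sum_congr rfl fun i _ => ?_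
    rw [← map_smul, ← Pi.single_smul]
    simp
  refine ⟨fun i => f (Pi.single i 1), by rwa [key], fun θ hθ => ?_⟩
  rw [key]
  exact hker (Submodule.subset_span
    ⟨⟨θ, Finset.mem_insert_of_mem hθ⟩, hθ, rfl⟩)

theorem nrcVec_smul_eq_smul_iff {n : ℕ} {v : Fin (n + 1) → E} (hv : LinearIndependent F v)
    {a b : F} {p p' : Fin 2 → F} :
    a • nrcVec v p = b • nrcVec v p' ↔ a • monomials n p = b • monomials n p' := by
  rw [nrcVec_eq_linearCombination, nrcVec_eq_linearCombination, ← map_smul, ← map_smul]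
  exact (linearIndependent_iff_injective_fintypeLinearCombination.1 hv).eq_iff

theorem monomials_ne_zero (n : ℕ) {p : Fin 2 → F} (hp : p ≠ 0) : monomials n p ≠ 0 := by
  intro h
  apply hp
  funext j
  have h0 := congrFun h 0
  have h1 := congrFun h (Fin.last n)
  simp only [monomials, Fin.val_zero, Nat.sub_zero, pow_zero, mul_one, Fin.val_last, Nat.sub_self,
    one_mul, Pi.zero_apply] at h0 h1
  fin_cases j
  · exact eq_zero_of_pow_eq_zero h0
  · exact eq_zero_of_pow_eq_zero h1

/-- The first two monomials have ratio x : y when x ≠ 0, and x = 0 is detected by the first. The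
degree is `n + 1` because in degree 0 nothing is recovered. -/
theorem exists_smul_eq_of_monomials {n : ℕ} {p p' : Fin 2 → F} (hp : p ≠ 0) (hp' : p' ≠ 0)
    {a b : F} (hb : b ≠ 0) (h : b • monomials (n + 1) p' = a • monomials (n + 1) p) :
    ∃ t : F, t ≠ 0 ∧ p' = t • p := by
  apply exists_smul_eq_of_cross_eq_zero hp hp'
  have ha : a ≠ 0 := by
    rintro rfl
    rw [zero_smul] at h
    exact (smul_ne_zero hb (monomials_ne_zero _ hp')) h
  have h0 := congrFun h 0
  have h1 := congrFun h 1
  simp only [monomials, Pi.smul_apply, smul_eq_mul, Fin.val_zero, Nat.sub_zero, pow_zero, mul_one,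
    Fin.val_one, Nat.add_sub_cancel, pow_one] at h0 h1
  unfold cross
  by_cases hz : p 0 = 0
  · have : p' 0 = 0 := by simpa [hz, hb] using h0
    simp [hz, this]
  · have hz' : p' 0 ≠ 0 := by
      intro hz'
      rw [hz', zero_pow (by omega), mul_zero] at h0
      exact (mul_ne_zero ha (pow_ne_zero _ hz)) h0.symm
    have hc : b * a * p 0 ^ n * p' 0 ^ n ≠ 0 := by positivity
    apply mul_left_cancel₀ hc
    rw [pow_succ] at h0
    linear_combination a * p 0 ^ n * p 0 * h1 - a * p 0 ^ n * p 1 * h0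

end NormalRationalCurves

/-! ### Coordinates on the scroll and its linear sections. -/

section Frames

variable {F E : Type*} [Field F] [AddCommGroup E] [Module F E]
  (B : Module.Basis (Fin 3 ⊕ Fin 4) F E)

/-- The vector with coordinates `(s, t)` on the generator with parameter `p`. -/
noncomputable def scrollVec (s t : F) (p : Fin 2 → F) : E :=
  s • nrcVec (fun i => B (Sum.inl i)) p + t • nrcVec (fun i => B (Sum.inr i)) p

theorem repr_scrollVec_inl (s t : F) (p : Fin 2 → F) (i : Fin 3) :
    B.repr (scrollVec B s t p) (Sum.inl i) = s * monomials 2 p i := by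
  simp [scrollVec, nrcVec_eq_sum, Finsupp.single_apply]

theorem repr_scrollVec_inr (s t : F) (p : Fin 2 → F) (i : Fin 4) :
    B.repr (scrollVec B s t p) (Sum.inr i) = t * monomials 3 p i := by
  simp [scrollVec, nrcVec_eq_sum, Finsupp.single_apply]

theorem scrollVec_smul_param (s t u : F) (p : Fin 2 → F) :
    scrollVec B s t (u • p) = scrollVec B (s * u ^ 2) (t * u ^ 3) p := by
  simp only [scrollVec, nrcVec_smul, smul_smul]

theorem smul_scrollVec (u s t : F) (p : Fin 2 → F) :
    u • scrollVec B s t p = scrollVec B (u * s) (u * t) p := by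
  simp only [scrollVec, smul_add, smul_smul]

/-- The frame of the twisted cubic cut out by the linear form `a x + b y`. -/
noncomputable def sectionFrame (a b : F) : Fin 4 → E :=
  ![B (Sum.inr 0) + a • B (Sum.inl 0),
    B (Sum.inr 1) + (a • B (Sum.inl 1) + b • B (Sum.inl 0)),
    B (Sum.inr 2) + (a • B (Sum.inl 2) + b • B (Sum.inl 1)),
    B (Sum.inr 3) + b • B (Sum.inl 2)]

theorem nrcVec_sectionFrame (a b : F) (p : Fin 2 → F) :
    nrcVec (sectionFrame B a b) p = scrollVec B (a * p 0 + b * p 1) 1 p := by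
  simp only [nrcVec, scrollVec, sectionFrame, Fin.sum_univ_succ, Fin.sum_univ_zero,
    Matrix.cons_val_zero, Matrix.cons_val_succ, Fin.val_zero, Fin.val_succ, Fin.succ_zero_eq_one,
    Fin.succ_one_eq_two]
  simp only [show (Fin.succ 2 : Fin 4) = 3 from rfl]
  module

theorem linearIndependent_sectionFrame (a b : F) : LinearIndependent F (sectionFrame B a b) := by
  rw [Fintype.linearIndependent_iff]
  intro g hg
  have h : ∀ i, B.repr (∑ j, g j • sectionFrame B a b j) (Sum.inr i) = 0 := by
    intro i
    rw [hg]
    simp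
  intro i
  have := h i
  simp only [sectionFrame, Fin.sum_univ_succ, Fin.sum_univ_zero] at this
  fin_cases i <;> simpa [Finsupp.single_apply] using this

end Frames

/-! ### Every twisted cubic on the scroll is a linear section. -/

section Classification

variable {F E : Type*} [Field F] [Finite F] [AddCommGroup E] [Module F E]
  (B : Module.Basis (Fin 3 ⊕ Fin 4) F E)

/-- The quartic forms y T₀ − x T₁ and y T₁ − x T₂ vanish at all parameters, of which there are at
least 5, hence identically. Comparing coefficients leaves T = (a x + b y)(x², xy, y²). -/
theorem coefficients_of_proportional (hq : 5 ≤ Nat.card (ℙ F (Fin 2 → F)))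
    (T : Matrix (Fin 3) (Fin 4) F)
    (h : ∀ θ : ℙ F (Fin 2 → F), ∃ u : F, ∀ i, nrcVec (T i) θ.rep = u * monomials 2 θ.rep i) :
    ∀ p i, nrcVec (T i) p = (T 0 0 * p 0 + T 0 1 * p 1) * monomials 2 p i := by
  have := Fintype.ofFinite (ℙ F (Fin 2 → F))
  rw [Nat.card_eq_fintype_card] at hq
  have h1 := eq_zero_of_nrcVec_eq_zero (n := 4)
    ![-T 1 0, T 0 0 - T 1 1, T 0 1 - T 1 2, T 0 2 - T 1 3, T 0 3] (S := Finset.univ) hq (by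
      intro θ _
      obtain ⟨u, hu⟩ := h θ
      have e0 := hu 0
      have e1 := hu 1
      simp [nrcVec, monomials, Fin.sum_univ_succ] at e0 e1 ⊢
      linear_combination θ.rep 1 * e0 - θ.rep 0 * e1)
  have h2 := eq_zero_of_nrcVec_eq_zero (n := 4)
    ![-T 2 0, T 1 0 - T 2 1, T 1 1 - T 2 2, T 1 2 - T 2 3, T 1 3] (S := Finset.univ) hq (by
      intro θ _
      obtain ⟨u, hu⟩ := h θ
      have e0 := hu 1
      have e1 := hu 2
      simp [nrcVec, monomials, Fin.sum_univ_succ] at e0 e1 ⊢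
      linear_combination θ.rep 1 * e0 - θ.rep 0 * e1)
  have a0 := congrFun h1 0
  have a1 := congrFun h1 1
  have a2 := congrFun h1 2
  have a3 := congrFun h1 3
  have a4 := congrFun h1 4
  have b0 := congrFun h2 0
  have b1 := congrFun h2 1
  have b2 := congrFun h2 2
  have b3 := congrFun h2 3
  have b4 := congrFun h2 4
  simp at a0 a1 a2 a3 a4 b0 b1 b2 b3 b4
  have c0 : T 1 1 = T 0 0 := by linear_combination -a1
  have c1 : T 1 2 = T 0 1 := by linear_combination -a2
  have c2 : T 0 2 = 0 := by linear_combination a3 + b4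
  have c3 : T 2 1 = 0 := by linear_combination a0 - b1
  have c4 : T 2 2 = T 0 0 := by linear_combination -a1 - b2
  have c5 : T 2 3 = T 0 1 := by linear_combination -a2 - b3
  intro p i
  fin_cases i <;> simp [nrcVec, monomials, Fin.sum_univ_succ, *] <;> ring

/-- A singular projection would confine every point with t ≠ 0 to the at most 3 generators over the
roots of a cubic form g. Isolating one of these generators by another cubic form rules out such
points, so the whole curve would lie in the plane of the conic. -/
theorem det_ne_zero_of_scrollVec (hq : 7 ≤ Nat.card (ℙ F (Fin 2 → F))) {v : Fin 4 → E}
    (hv : LinearIndependent F v) {Θ : ℙ F (Fin 2 → F) → ℙ F (Fin 2 → F)}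
    {s t : ℙ F (Fin 2 → F) → F}
    (h : ∀ ε, nrcVec v ε.rep = scrollVec B (s ε) (t ε) (Θ ε).rep) :
    (Matrix.of fun i j => B.repr (v j) (Sum.inr i)).det ≠ 0 := by
  classical
  have := Fintype.ofFinite (ℙ F (Fin 2 → F))
  have : FiniteDimensional F E := B.finiteDimensional_of_finite
  rw [Nat.card_eq_fintype_card] at hq
  have hq4 : 3 + 1 ≤ Nat.card (ℙ F (Fin 2 → F)) := by rw [Nat.card_eq_fintype_card]; omega
  intro hdet
  obtain ⟨g, hg0, hg⟩ := Matrix.exists_vecMul_eq_zero_iff.2 hdet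
  -- A cubic form k on the 3-space coordinates pulls back along the projection to a cubic form in ε.
  have key : ∀ (k : Fin 4 → F) (ε : ℙ F (Fin 2 → F)),
      nrcVec (Matrix.vecMul k (Matrix.of fun i j => B.repr (v j) (Sum.inr i))) ε.rep =
        t ε * nrcVec k (Θ ε).rep := by
    intro k ε
    have e : ∀ i, ∑ j, monomials 3 ε.rep j * B.repr (v j) (Sum.inr i) =
        t ε * monomials 3 (Θ ε).rep i := by
      intro i
      rw [← repr_scrollVec_inr B (s ε), ← h ε]
      simp [nrcVec_eq_sum]
    simp only [nrcVec_eq_sum, Matrix.vecMul, dotProduct, Matrix.of_apply, smul_eq_mul,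
      Finset.mul_sum]
    rw [Finset.sum_comm]
    refine Finset.sum_congr rfl fun i _ => ?_
    rw [← mul_assoc, ← e i, Finset.sum_mul]
    exact Finset.sum_congr rfl fun j _ => by ring
  have hroot : ∀ ε, t ε = 0 ∨ nrcVec g (Θ ε).rep = 0 := by
    intro ε
    have := key g ε
    rw [hg] at this
    simpa [nrcVec] using this
  set R : Finset (ℙ F (Fin 2 → F)) := {θ | nrcVec g θ.rep = 0} with hR
  have hRcard : R.card ≤ 3 := by
    by_contra! hlt
    exact hg0 (eq_zero_of_nrcVec_eq_zero g (S := R) hlt fun θ hθ => by simpa [hR] using hθ)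
  -- A fibre of Θ consists of curve points on a single generator, which is a line.
  have hfiber : ∀ r, (Finset.univ.filter fun ε => Θ ε = r).card ≤ 2 := by
    intro r
    set U := Submodule.span F
      (({nrcVec (fun i => B (Sum.inl i)) r.rep, nrcVec (fun i => B (Sum.inr i)) r.rep} :
        Finset E) : Set E) with hU
    have hfin : Module.finrank F U ≤ 2 := (finrank_span_finset_le_card _).trans Finset.card_le_two
    refine (card_le_finrank_of_nrcVec_mem hv hq4 (U := U) (by omega) fun ε hε => ?_).trans hfin
    rw [h ε, (Finset.mem_filter.1 hε).2]
    exact add_mem (Submodule.smul_mem _ _ (Submodule.subset_span (by simp)))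
      (Submodule.smul_mem _ _ (Submodule.subset_span (by simp)))
  have ht : ∀ ε, t ε = 0 := by
    intro ε
    by_contra hε
    have hmem : Θ ε ∈ R := by
      rw [hR, Finset.mem_filter]
      exact ⟨Finset.mem_univ _, (hroot ε).resolve_left hε⟩
    -- k kills the other roots of g, so its pullback vanishes off the fibre of `Θ ε`, at no fewer
    -- than 7 − 2 parameters, too many for a nonzero cubic form.
    obtain ⟨k, hk, hk0⟩ := exists_nrcVec_ne_zero (n := 3) hq4 (S := R.erase (Θ ε))
      ((Finset.card_erase_le).trans hRcard) (Finset.notMem_erase _ _)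
    have hzero := eq_zero_of_nrcVec_eq_zero (n := 3) _ (S := Finset.univ.filter fun ε' => ¬ Θ ε' = Θ ε)
      (by
        have := hfiber (Θ ε)
        have := Finset.card_filter_add_card_filter_not (s := Finset.univ) fun ε' => Θ ε' = Θ ε
        rw [Finset.card_univ] at this
        omega) fun ε' hε' => by
        rw [key k ε']
        rcases hroot ε' with h0 | h0
        · rw [h0, zero_mul]
        · rw [hk0 _ (Finset.mem_erase.2 ⟨(Finset.mem_filter.1 hε').2, by simpa [hR] using h0⟩),
            mul_zero]
    have := key k ε
    rw [hzero] at this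
    have h' : t ε * nrcVec k (Θ ε).rep = 0 := by rw [← this]; simp [nrcVec]
    exact (mul_ne_zero hε hk) h'
  set U := Submodule.span F (Set.range fun i : Fin 3 => B (Sum.inl i)) with hU
  have hfin : Module.finrank F U ≤ 3 :=
    (finrank_range_le_card (R := F) fun i : Fin 3 => B (Sum.inl i)).trans (by simp)
  have := card_le_finrank_of_nrcVec_mem hv (S := Finset.univ) hq4 (U := U) (by omega) fun ε _ => by
    rw [h ε, ht ε, scrollVec, zero_smul, add_zero]
    refine Submodule.smul_mem _ _ (Submodule.sum_mem _ fun i _ => Submodule.smul_mem _ _ ?_)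
    exact Submodule.subset_span ⟨i, rfl⟩
  rw [Finset.card_univ] at this
  omega

/-- A twisted cubic on the scroll is cut out by a linear form. -/
theorem exists_eq_smul_sectionFrame (hq : 7 ≤ Nat.card (ℙ F (Fin 2 → F))) {v : Fin 4 → E}
    (hv : LinearIndependent F v) {Θ : ℙ F (Fin 2 → F) → ℙ F (Fin 2 → F)}
    {s t : ℙ F (Fin 2 → F) → F}
    (h : ∀ ε, nrcVec v ε.rep = scrollVec B (s ε) (t ε) (Θ ε).rep) :
    ∃ a b : F, ∀ ε, nrcVec v ε.rep = t ε • nrcVec (sectionFrame B a b) (Θ ε).rep := by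
  have := Fintype.ofFinite (ℙ F (Fin 2 → F))
  set M : Matrix (Fin 4) (Fin 4) F := Matrix.of fun i j => B.repr (v j) (Sum.inr i) with hM
  set C : Matrix (Fin 3) (Fin 4) F := Matrix.of fun i j => B.repr (v j) (Sum.inl i) with hC
  have hdet : IsUnit M.det := (det_ne_zero_of_scrollVec B hq hv h).isUnit
  have eM : ∀ ε : ℙ F (Fin 2 → F),
      M.mulVec (monomials 3 ε.rep) = t ε • monomials 3 (Θ ε).rep := by
    intro ε
    funext i
    rw [Pi.smul_apply, smul_eq_mul, ← repr_scrollVec_inr B (s ε), ← h ε]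
    simp [nrcVec_eq_sum, Matrix.mulVec, dotProduct, hM, mul_comm]
  have eC : ∀ ε : ℙ F (Fin 2 → F),
      C.mulVec (monomials 3 ε.rep) = s ε • monomials 2 (Θ ε).rep := by
    intro ε
    funext i
    rw [Pi.smul_apply, smul_eq_mul, ← repr_scrollVec_inl B _ (t ε), ← h ε]
    simp [nrcVec_eq_sum, Matrix.mulVec, dotProduct, hC, mul_comm]
  have ht : ∀ ε, t ε ≠ 0 := by
    intro ε h0
    have h1 := eM ε
    rw [h0, zero_smul] at h1
    exact monomials_ne_zero 3 ε.rep_nonzero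
      (Matrix.eq_zero_of_mulVec_eq_zero hdet.ne_zero h1)
  -- Parameters with the same Θ have proportional images under the invertible M.
  have hinj : Function.Injective Θ := by
    intro ε ε' hε
    have h1 : M.mulVec (t ε' • monomials 3 ε.rep) = M.mulVec (t ε • monomials 3 ε'.rep) := by
      rw [Matrix.mulVec_smul, Matrix.mulVec_smul, eM, eM, hε, smul_comm]
    have h2 := Matrix.mulVec_injective_of_isUnit ((Matrix.isUnit_iff_isUnit_det M).2 hdet) h1
    obtain ⟨u, -, hu⟩ :=
      exists_smul_eq_of_monomials (n := 2) ε.rep_nonzero ε'.rep_nonzero (ht ε) h2.symm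
    rw [← ε.mk_rep, ← ε'.mk_rep, eq_comm, Projectivization.mk_eq_mk_iff']
    exact ⟨u, hu.symm⟩
  have hsurj : Function.Surjective Θ := Finite.surjective_of_injective hinj
  -- T expresses the conic part of a curve point through its cubic part; as Θ is onto, its rows
  -- satisfy the proportionality at every parameter.
  set T := C * M⁻¹ with hT
  have eT : ∀ ε i, t ε * nrcVec (T i) (Θ ε).rep = s ε * monomials 2 (Θ ε).rep i := by
    intro ε i
    have h1 : T.mulVec (t ε • monomials 3 (Θ ε).rep) = s ε • monomials 2 (Θ ε).rep := by
      rw [← eM, ← eC, Matrix.mulVec_mulVec, hT, Matrix.mul_assoc, Matrix.nonsing_inv_mul M hdet,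
        Matrix.mul_one]
    have h2 := congrFun h1 i
    rw [Matrix.mulVec_smul, Pi.smul_apply, Pi.smul_apply, smul_eq_mul, smul_eq_mul] at h2
    rw [← h2]
    simp [nrcVec_eq_sum, Matrix.mulVec, dotProduct, mul_comm]
  have hcoef := coefficients_of_proportional (by omega) T fun θ => by
    obtain ⟨ε, rfl⟩ := hsurj θ
    refine ⟨s ε / t ε, fun i => ?_⟩
    have := eT ε i
    have := ht ε
    field_simp
    linear_combination eT ε i
  refine ⟨T 0 0, T 0 1, fun ε => ?_⟩
  rw [nrcVec_sectionFrame, h ε, smul_scrollVec, mul_one]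
  congr 1
  obtain ⟨i, hi⟩ := Function.ne_iff.1 (monomials_ne_zero 2 (Θ ε).rep_nonzero)
  apply mul_right_cancel₀ hi
  rw [← eT, hcoef]
  ring

end Classification

/-! ### From vectors to projective points. -/

section Points

variable {F E : Type*} [Field F] [AddCommGroup E] [Module F E]

theorem mk_mem_pointsOf {W : Submodule F E} {x : E} (hx : x ≠ 0) :
    Projectivization.mk F x hx ∈ pointsOf W ↔ x ∈ W := by
  simp [pointsOf, Projectivization.submodule_mk]

theorem disjoint_of_disjoint_pointsOf {W W' : Submodule F E}
    (h : Disjoint (pointsOf W) (pointsOf W')) : Disjoint W W' := by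
  rw [Submodule.disjoint_def]
  intro x hx hx'
  by_contra h0
  exact Set.disjoint_left.1 h ((mk_mem_pointsOf h0).2 hx) ((mk_mem_pointsOf h0).2 hx')

theorem nrcPoint_mk {n : ℕ} {v : Fin (n + 1) → E} (hv : LinearIndependent F v) {p : Fin 2 → F}
    (hp : p ≠ 0) : nrcPoint v hv (Projectivization.mk F p hp) =
      Projectivization.mk F (nrcVec v p) (nrcVec_ne_zero hv hp) := rfl

theorem nrcPoint_eq {n : ℕ} {v : Fin (n + 1) → E} (hv : LinearIndependent F v)
    (θ : ℙ F (Fin 2 → F)) : nrcPoint v hv θ =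
      Projectivization.mk F (nrcVec v θ.rep) (nrcVec_ne_zero hv θ.rep_nonzero) := by
  conv_lhs => rw [← θ.mk_rep]
  rw [nrcPoint_mk]

theorem nrcPoint_injective {n : ℕ} {v : Fin (n + 2) → E} (hv : LinearIndependent F v) :
    Function.Injective (nrcPoint v hv) := by
  intro θ θ' h
  rw [nrcPoint_eq, nrcPoint_eq, Projectivization.mk_eq_mk_iff'] at h
  obtain ⟨a, ha⟩ := h
  have h1 : (1 : F) • nrcVec v θ.rep = a • nrcVec v θ'.rep := by rw [one_smul, ha]
  obtain ⟨t, -, ht⟩ := exists_smul_eq_of_monomials θ'.rep_nonzero θ.rep_nonzero one_ne_zero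
    ((nrcVec_smul_eq_smul_iff hv).1 h1)
  rw [← θ.mk_rep, ← θ'.mk_rep, Projectivization.mk_eq_mk_iff']
  exact ⟨t, ht.symm⟩

theorem mk_mem_range_nrcPoint {n : ℕ} {v : Fin (n + 1) → E} (hv : LinearIndependent F v) {x : E}
    (hx : x ≠ 0) : Projectivization.mk F x hx ∈ Set.range (nrcPoint v hv) ↔
      ∃ p : Fin 2 → F, p ≠ 0 ∧ ∃ u : F, x = u • nrcVec v p := by
  constructor
  · rintro ⟨θ, hθ⟩
    rw [nrcPoint_eq, eq_comm, Projectivization.mk_eq_mk_iff'] at hθ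
    obtain ⟨u, hu⟩ := hθ
    exact ⟨θ.rep, θ.rep_nonzero, u, hu.symm⟩
  · rintro ⟨p, hp, u, hu⟩
    refine ⟨Projectivization.mk F p hp, ?_⟩
    rw [nrcPoint_mk, eq_comm, Projectivization.mk_eq_mk_iff']
    exact ⟨u, hu.symm⟩

theorem ncard_range_nrcPoint [Finite F] {n : ℕ} {v : Fin (n + 2) → E}
    (hv : LinearIndependent F v) :
    (Set.range (nrcPoint v hv)).ncard = Nat.card (ℙ F (Fin 2 → F)) := by
  rw [← Set.image_univ, Set.ncard_image_of_injective _ (nrcPoint_injective hv), Set.ncard_univ]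

end Points

/-! ### Incidence and intersection of linear sections. -/

section Sections

variable {F E : Type*} [Field F] [AddCommGroup E] [Module F E]
  (B : Module.Basis (Fin 3 ⊕ Fin 4) F E)

/-- The twisted cubic cut out on the scroll by the linear form `a x + b y`. -/
def sectionCubic (a b : F) : Set (ℙ F E) :=
  Set.range (nrcPoint (sectionFrame B a b) (linearIndependent_sectionFrame B a b))

theorem isTwistedCubic_sectionCubic (a b : F) : IsTwistedCubic (sectionCubic B a b) :=
  ⟨_, linearIndependent_sectionFrame B a b, rfl⟩

/-- Since t ≠ 0, the cubic coordinates fix the parameter up to a scalar, and the conic coordinates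
then compare s. A point off the conic thus imposes one linear condition on (a, b). -/
theorem mk_scrollVec_mem_sectionCubic {a b s t : F} {p : Fin 2 → F} (hp : p ≠ 0) (ht : t ≠ 0)
    (hx : scrollVec B s t p ≠ 0) :
    Projectivization.mk F (scrollVec B s t p) hx ∈ sectionCubic B a b ↔
      s = t * (a * p 0 + b * p 1) := by
  rw [sectionCubic, mk_mem_range_nrcPoint]
  constructor
  · rintro ⟨r, hr, u, hu⟩
    rw [nrcVec_sectionFrame, smul_scrollVec, mul_one] at hu
    have h3 : t • monomials 3 p = u • monomials 3 r := by
      funext i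
      simp only [Pi.smul_apply, smul_eq_mul]
      rw [← repr_scrollVec_inr B s, hu, repr_scrollVec_inr]
    obtain ⟨k, hk, rfl⟩ := exists_smul_eq_of_monomials hr hp ht h3
    rw [monomials_smul, smul_smul] at h3
    have h3' : t * k ^ 3 = u := smul_left_injective F (monomials_ne_zero 3 hr) h3
    have h2 : (s * k ^ 2) • monomials 2 r = (u * (a * r 0 + b * r 1)) • monomials 2 r := by
      rw [← smul_smul, ← monomials_smul]
      funext i
      simp only [Pi.smul_apply, smul_eq_mul]
      rw [← repr_scrollVec_inl B s t, hu, repr_scrollVec_inl]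
    have h2' : s * k ^ 2 = u * (a * r 0 + b * r 1) :=
      smul_left_injective F (monomials_ne_zero 2 hr) h2
    apply mul_right_cancel₀ (pow_ne_zero 2 hk)
    simp only [Pi.smul_apply, smul_eq_mul]
    rw [h2', ← h3']
    ring
  · intro h
    exact ⟨p, hp, t, by rw [nrcVec_sectionFrame, smul_scrollVec, mul_one, h]⟩

theorem existsUnique_mem_sectionCubic {a b a' b' : F} (h : ¬(a = a' ∧ b = b')) :
    ∃! P, P ∈ sectionCubic B a b ∧ P ∈ sectionCubic B a' b' := by
  -- The zero of the difference (a − a') x + (b − b') y.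
  set p : Fin 2 → F := ![b - b', a' - a] with hp
  have p0 : p 0 = b - b' := rfl
  have p1 : p 1 = a' - a := rfl
  have hp0 : p ≠ 0 := by
    intro h0
    have h1 := congrFun h0 0
    have h2 := congrFun h0 1
    rw [p0, Pi.zero_apply, sub_eq_zero] at h1
    rw [p1, Pi.zero_apply, sub_eq_zero] at h2
    exact h ⟨h2.symm, h1⟩
  have hx : scrollVec B (a * p 0 + b * p 1) 1 p ≠ 0 := by
    rw [← nrcVec_sectionFrame]
    exact nrcVec_ne_zero (linearIndependent_sectionFrame B a b) hp0
  refine ⟨Projectivization.mk F _ hx, ⟨?_, ?_⟩, ?_⟩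
  · rw [mk_scrollVec_mem_sectionCubic B hp0 one_ne_zero, one_mul]
  · rw [mk_scrollVec_mem_sectionCubic B hp0 one_ne_zero, one_mul, p0, p1]
    ring
  · rintro P ⟨⟨θ, rfl⟩, h2⟩
    have hθ := θ.rep_nonzero
    rw [nrcPoint_eq] at h2 ⊢
    simp only [nrcVec_sectionFrame] at h2 ⊢
    rw [mk_scrollVec_mem_sectionCubic B hθ one_ne_zero, one_mul] at h2
    obtain ⟨k, -, hk⟩ := exists_smul_eq_of_cross_eq_zero hp0 hθ (by
      rw [cross, p0, p1]
      linear_combination h2)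
    rw [Projectivization.mk_eq_mk_iff']
    refine ⟨k ^ 3, ?_⟩
    rw [hk, scrollVec_smul_param, smul_scrollVec]
    simp only [Pi.smul_apply, smul_eq_mul]
    congr 1 <;> ring

end Sections

/-! ### Change of parameter on the conic. -/

section Reparametrization

variable {F E : Type*} [Field F] [AddCommGroup E] [Module F E]

/-- The frame of the conic after the change of parameters by `h`. -/
def reparametrize (h : Matrix (Fin 2) (Fin 2) F) (c : Fin 3 → E) : Fin 3 → E :=
  ![(h 0 0 ^ 2) • c 0 + (h 0 0 * h 1 0) • c 1 + (h 1 0 ^ 2) • c 2,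
    (2 * h 0 0 * h 0 1) • c 0 + (h 0 0 * h 1 1 + h 0 1 * h 1 0) • c 1 +
      (2 * h 1 0 * h 1 1) • c 2,
    (h 0 1 ^ 2) • c 0 + (h 0 1 * h 1 1) • c 1 + (h 1 1 ^ 2) • c 2]

theorem nrcVec_reparametrize
    (h : Matrix (Fin 2) (Fin 2) F) (c : Fin 3 → E) (p : Fin 2 → F) :
    nrcVec (reparametrize h c) p = nrcVec c (h.mulVec p) := by
  simp only [nrcVec, reparametrize, Matrix.mulVec, dotProduct, Fin.sum_univ_succ,
    Fin.sum_univ_zero, Matrix.cons_val_zero, Matrix.cons_val_succ, Fin.val_zero, Fin.val_succ,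
    Fin.succ_zero_eq_one, Fin.succ_one_eq_two]
  module

theorem cross_mulVec (h : Matrix (Fin 2) (Fin 2) F) (p p' : Fin 2 → F) :
    cross (h.mulVec p) (h.mulVec p') = h.det * cross p p' := by
  simp [cross, Matrix.mulVec, dotProduct, Fin.sum_univ_two, Matrix.det_fin_two]
  ring

/-- Three points of the conic are independent and lie in the span of the new frame, so that frame
has rank 3. This holds in every characteristic. -/
theorem linearIndependent_reparametrize [Finite F]
    (hq : 3 ≤ Nat.card (ℙ F (Fin 2 → F))) {h : Matrix (Fin 2) (Fin 2) F} (hh : h.det ≠ 0)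
    {c : Fin 3 → E} (hc : LinearIndependent F c) : LinearIndependent F (reparametrize h c) := by
  have := Fintype.ofFinite (ℙ F (Fin 2 → F))
  rw [Nat.card_eq_fintype_card] at hq
  obtain ⟨T, -, hT⟩ := Finset.exists_subset_card_eq (s := (Finset.univ : Finset (ℙ F (Fin 2 → F))))
    (n := 3) hq
  have e : Fin 3 ≃ T := (T.equivFinOfCardEq hT).symm
  have h1 := linearIndependent_monomials_of_cross (n := 2)
    (p := fun i => h.mulVec (e i : ℙ F (Fin 2 → F)).rep) fun i j hij h0 => by
      rw [cross_mulVec] at h0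
      exact hij (e.injective (Subtype.ext
        (eq_of_cross_rep_eq_zero ((mul_eq_zero.1 h0).resolve_left hh))))
  have h2 := h1.map' (Fintype.linearCombination F c)
    (LinearMap.ker_eq_bot.2 (linearIndependent_iff_injective_fintypeLinearCombination.1 hc))
  have h3 : ∀ i, nrcVec c (h.mulVec (e i : ℙ F (Fin 2 → F)).rep) ∈
      Submodule.span F (Set.range (reparametrize h c)) := by
    intro i
    rw [← nrcVec_reparametrize]
    exact Submodule.sum_mem _ fun j _ => Submodule.smul_mem _ _ (Submodule.subset_span ⟨j, rfl⟩)
  have h4 : LinearIndependent F fun i => (⟨_, h3 i⟩ :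
      Submodule.span F (Set.range (reparametrize h c))) :=
    LinearIndependent.of_comp (Submodule.subtype _) h2
  rw [linearIndependent_iff_card_le_finrank_span]
  have := FiniteDimensional.span_of_finite F (Set.finite_range (reparametrize h c))
  exact h4.fintype_card_le_finrank

end Reparametrization

/-! ### The adapted basis of a scroll. -/

namespace Scroll

variable {F : Type*} [Field F] [Finite F] (S : Scroll F)

/-- In a suitable basis of the space, both directrices are parametrized in the same way. -/
theorem exists_basis (hq : 3 ≤ Nat.card (ℙ F (Fin 2 → F))) :
    ∃ B : Module.Basis (Fin 3 ⊕ Fin 4) F (Fin 7 → F),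
      (∀ θ x (hx : x ≠ 0), Projectivization.mk F x hx ∈ S.generator θ ↔
        ∃ s t, x = scrollVec B s t (S.φ • θ).rep) ∧
      ∀ s p, p ≠ 0 → ∀ hx, Projectivization.mk F (scrollVec B s 0 p) hx ∈ S.conicDirectrix := by
  obtain ⟨g, hg⟩ := Matrix.ProjGenLinGroup.mk_surjective S.φ
  -- With the inverse of φ on the conic, the parameter `S.φ • θ` names both ends of the generator of
  -- θ.
  set h : Matrix (Fin 2) (Fin 2) F := (g⁻¹ : GL (Fin 2) F).1 with hh
  have hdet : h.det ≠ 0 := ((Matrix.isUnit_iff_isUnit_det h).1 (g⁻¹ : GL (Fin 2) F).isUnit).ne_zero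
  have hgh : ∀ p : Fin 2 → F, h.mulVec (g • p) = p := by
    intro p
    exact inv_smul_smul g p
  have hne : ∀ p : Fin 2 → F, p ≠ 0 → h.mulVec p ≠ 0 := by
    intro p hp h0
    exact hp (Matrix.eq_zero_of_mulVec_eq_zero hdet h0)
  have hli : LinearIndependent F (Sum.elim (reparametrize h S.c) S.d) := by
    refine (linearIndependent_reparametrize hq hdet S.linearIndependent_c).sum_type
      S.linearIndependent_d ((disjoint_of_disjoint_pointsOf S.disjoint).mono_left ?_)
    have hm : ∀ j, S.c j ∈ Submodule.span F (Set.range S.c) :=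
      fun j => Submodule.subset_span ⟨j, rfl⟩
    rw [Submodule.span_le]
    rintro _ ⟨i, rfl⟩
    fin_cases i <;>
      exact add_mem (add_mem (Submodule.smul_mem _ _ (hm _)) (Submodule.smul_mem _ _ (hm _)))
        (Submodule.smul_mem _ _ (hm _))
  set B := basisOfLinearIndependentOfCardEqFinrank hli (by simp) with hB
  have hl : (fun i => B (Sum.inl i)) = reparametrize h S.c := by funext i; simp [hB]
  have hr : (fun i => B (Sum.inr i)) = S.d := by funext i; simp [hB]
  refine ⟨B, fun θ x hx => ?_, fun s p hp hx => ?_⟩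
  · have hφ : S.φ • θ = Projectivization.mk F (g • θ.rep)
        ((smul_ne_zero_iff_ne g).2 θ.rep_nonzero) := by
      conv_lhs => rw [← hg, ← θ.mk_rep]
      rfl
    obtain ⟨u, hu⟩ := Projectivization.exists_smul_eq_mk_rep F (g • θ.rep)
      ((smul_ne_zero_iff_ne g).2 θ.rep_nonzero)
    rw [generator, mk_mem_pointsOf, hφ, ← hu, nrcPoint_eq, nrcPoint_mk,
      Projectivization.submodule_mk, Projectivization.submodule_mk, Submodule.mem_sup]
    have hs : ∀ s t, scrollVec B s t (u • g • θ.rep) =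
        (s * (u : F) ^ 2) • nrcVec S.c θ.rep + (t * (u : F) ^ 3) • nrcVec S.d (g • θ.rep) := by
      intro s t
      rw [Units.smul_def, scrollVec_smul_param, scrollVec, hl, hr, nrcVec_reparametrize, hgh]
    have hu0 : (u : F) ≠ 0 := u.ne_zero
    constructor
    · rintro ⟨y, hy, z, hz, rfl⟩
      obtain ⟨a, rfl⟩ := Submodule.mem_span_singleton.1 hy
      obtain ⟨b, rfl⟩ := Submodule.mem_span_singleton.1 hz
      refine ⟨a / (u : F) ^ 2, b / (u : F) ^ 3, ?_⟩
      rw [hs, div_mul_cancel₀ _ (pow_ne_zero 2 hu0), div_mul_cancel₀ _ (pow_ne_zero 3 hu0)]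
    · rintro ⟨s, t, rfl⟩
      rw [hs]
      exact ⟨_, Submodule.mem_span_singleton.2 ⟨_, rfl⟩, _,
        Submodule.mem_span_singleton.2 ⟨_, rfl⟩, rfl⟩
  · rw [conicDirectrix, mk_mem_range_nrcPoint]
    refine ⟨h.mulVec p, hne p hp, s, ?_⟩
    rw [scrollVec, zero_smul, add_zero, hl, nrcVec_reparametrize]

end Scroll

end RuledQuintic

/-! ### Intersection and interpolation of twisted cubics. -/

open RuledQuintic in
theorem mainTheorem8 {F : Type*} [Field F] [Fintype F] (hq : 6 ≤ Fintype.card F)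
    (S : RuledQuintic.Scroll F) :
    (∀ N₁ N₂ : Set (ℙ F (Fin 7 → F)),
      RuledQuintic.IsTwistedCubic N₁ → RuledQuintic.IsTwistedCubic N₂ →
      N₁ ⊆ S.surface → N₂ ⊆ S.surface → N₁ ≠ N₂ → ∃! P, P ∈ N₁ ∧ P ∈ N₂) ∧
    (∀ ℓ ∈ S.generators, ∀ m ∈ S.generators, ℓ ≠ m →
      ∀ P ∈ ℓ, ∀ Q ∈ m, P ∉ S.conicDirectrix → Q ∉ S.conicDirectrix →
        ∃! N : Set (ℙ F (Fin 7 → F)),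
          RuledQuintic.IsTwistedCubic N ∧ N ⊆ S.surface ∧ P ∈ N ∧ Q ∈ N) := by
  have hcard : 7 ≤ Nat.card (ℙ F (Fin 2 → F)) := by
    rw [Projectivization.card_of_finrank_two F (Fin 2 → F) (by simp), Nat.card_eq_fintype_card]
    omega
  obtain ⟨B, hgen, hconic⟩ := S.exists_basis (by omega)
  have hclass : ∀ N : Set (ℙ F (Fin 7 → F)), IsTwistedCubic N → N ⊆ S.surface →
      ∃ a b, N = sectionCubic B a b := by
    rintro N ⟨v, hv, rfl⟩ hN
    have h : ∀ ε : ℙ F (Fin 2 → F), ∃ θ : ℙ F (Fin 2 → F), ∃ s t,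
        nrcVec v ε.rep = scrollVec B s t θ.rep := by
      intro ε
      obtain ⟨θ, hθ⟩ := Set.mem_iUnion.1 (hN ⟨ε, rfl⟩)
      rw [nrcPoint_eq, hgen] at hθ
      exact ⟨_, hθ⟩
    choose Θ s t h using h
    obtain ⟨a, b, hab⟩ := exists_eq_smul_sectionFrame B hcard hv h
    -- Both curves have as many points as there are parameters, so one inclusion suffices.
    refine ⟨a, b, Set.eq_of_subset_of_ncard_le ?_ ?_ (Set.finite_range _)⟩
    · rintro _ ⟨ε, rfl⟩
      rw [nrcPoint_eq, sectionCubic, mk_mem_range_nrcPoint]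
      exact ⟨_, (Θ ε).rep_nonzero, _, hab ε⟩
    · rw [sectionCubic, ncard_range_nrcPoint, ncard_range_nrcPoint]
  refine ⟨?_, ?_⟩
  · intro N₁ N₂ h₁ h₂ h₁' h₂' hne
    obtain ⟨a, b, rfl⟩ := hclass N₁ h₁ h₁'
    obtain ⟨a', b', rfl⟩ := hclass N₂ h₂ h₂'
    refine existsUnique_mem_sectionCubic B ?_
    rintro ⟨rfl, rfl⟩
    exact hne rfl
  · have hpoint : ∀ θ P, P ∈ S.generator θ → P ∉ S.conicDirectrix → ∃ f : F, ∀ a b,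
        P ∈ sectionCubic B a b ↔ f = a * (S.φ • θ).rep 0 + b * (S.φ • θ).rep 1 := by
      intro θ P hP hPc
      induction P using Projectivization.ind with
      | h x hx =>
      obtain ⟨s, t, rfl⟩ := (hgen θ x hx).1 hP
      have ht : t ≠ 0 := by
        rintro rfl
        exact hPc (hconic s _ (S.φ • θ).rep_nonzero hx)
      refine ⟨s / t, fun a b => ?_⟩
      rw [mk_scrollVec_mem_sectionCubic B (S.φ • θ).rep_nonzero ht, div_eq_iff ht, mul_comm]
    rintro _ ⟨θ, rfl⟩ _ ⟨θ', rfl⟩ hne P hP Q hQ hPc hQc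
    obtain ⟨f, hf⟩ := hpoint θ P hP hPc
    obtain ⟨f', hf'⟩ := hpoint θ' Q hQ hQc
    set p := (S.φ • θ).rep with hp
    set p' := (S.φ • θ').rep with hp'
    have hD : p 0 * p' 1 - p 1 * p' 0 ≠ 0 := by
      intro h0
      refine hne ?_
      rw [MulAction.injective S.φ (eq_of_cross_rep_eq_zero h0)]
    -- Cramer's rule for the linear form with value f at p and f' at p'; the determinant is nonzero
    -- because the generators differ.
    refine ⟨sectionCubic B ((f * p' 1 - f' * p 1) / (p 0 * p' 1 - p 1 * p' 0))
      ((f' * p 0 - f * p' 0) / (p 0 * p' 1 - p 1 * p' 0)),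
      ⟨isTwistedCubic_sectionCubic B _ _, ?_, ?_, ?_⟩, ?_⟩
    · rintro _ ⟨ε, rfl⟩
      refine Set.mem_iUnion.2 ⟨S.φ⁻¹ • ε, ?_⟩
      rw [nrcPoint_eq, hgen, smul_inv_smul]
      exact ⟨_, _, nrcVec_sectionFrame B _ _ _⟩
    · rw [hf]
      rw [div_mul_eq_mul_div, div_mul_eq_mul_div, ← add_div, eq_div_iff hD]
      ring
    · rw [hf']
      rw [div_mul_eq_mul_div, div_mul_eq_mul_div, ← add_div, eq_div_iff hD]
      ring
    · rintro N ⟨hN, hNS, hPN, hQN⟩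
      obtain ⟨a, b, rfl⟩ := hclass N hN hNS
      rw [hf] at hPN
      rw [hf'] at hQN
      congr 1
      · rw [eq_div_iff hD, hPN, hQN]
        ring
      · rw [eq_div_iff hD, hPN, hQN]
        ring
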